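/- Let $G=(V,A)$ be a finite graph, either undirected (undirected model) or directed and acyclic (directed model). Each vertex $v$ carries a random variable $X_v$ with values in a finite set $\mathcal X_v$, and $X_S=(X_v)_{v\in S}$ for $S\subseteq V$. A probability distribution $\mathbb P$ on $\prod_{v}\mathcal X_v$ (for any choice of finite sets $\mathcal X_v$) factorizes on $G$ if $\mathbb P(x)=\frac1Z\prod_{K\in\mathcal C}\psi_K(x_K)$ for a constant $Z$, a collection $\mathcal C$ of cliques of $G$ and functions $\psi_K\ge 0$ (undirected model), respectively if $\mathbb P(x)=\prod_{v\in V}p_v(x_v\mid x_{\mathrm{prt}(v)})$ for conditional distributions $p_v$ of $v$ given its set of parents $\mathrm{prt}(v)$ (directed model). In the undirected model, $X\perp Y\mid M$ ($M$ separates $X$ and $Y$) means that every path between a vertex of $X$ and a vertex of $Y$, endpoints included, contains a vertex of $M$. In the directed model, $X\perp Y\mid M$ ($M$ d-separates $X$ and $Y$) means that no trail $v_0,\dots,v_k$ with $v_0\in X$, $v_k\in Y$ (consecutive vertices joined by an arc in either direction, $k\ge 0$) is active given $M$. Here $v_i$ is a v-structure of the trail if $0<i<k$ and $(v_{i-1},v_i),(v_{i+1},v_i)\in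 A$, and the trail is active given $M$ if no vertex of it that is not a v-structure is in $M$, and every v-structure of it is in $M$ or has a descendant in $M$. For sets of vertices $B,C,E$, the Markov blanket $\mathrm{mb}_C(B|E)$ of $B$ in $C$ given $E$ is the smallest $M\subseteq C$ such that $X_B$ and $X_{C\setminus(B\cup M)}$ are independent given $X_{M\cup E}$ for every distribution that factorizes on $G$, where smallest means that a set $M\subseteq C$ has this property if and only if $\mathrm{mb}_C(B|E)\subseteq M$. Proposition. Let $B,C,C',E\subseteq V$ be such that $B\cap(C\cup C')\subseteq E$ (for instance $B$ disjoint from $C\cup C'$). Then, in both undirected and directed models, $\mathrm{mb}_C(B|E)$ and $\mathrm{mb}_{C\cup C'}(B|E)$ exist, and $$\mathrm{mb}_{C\cup C'}(B|E)=\mathrm{mb}_C(B|E)\quad\Longleftrightarrow\quad C'\perp B\mid C\cup E .$$ -/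

import Mathlib

open scoped BigOperators

namespace GraphicalModel

section Probability

variable {V : Type*} [Fintype V] [DecidableEq V] {𝒳 : V → Type} [∀ v, Fintype (𝒳 v)]

/-- The probability of an event under the probability mass function `p` on the finite
product space `∏ v, 𝒳 v`. -/
noncomputable def prob (p : (∀ v, 𝒳 v) → ℝ) (S : Set (∀ v, 𝒳 v)) : ℝ :=
  ∑ x, S.indicator p x

/-- The event `X_S = a_S`; only the coordinates of `a` in `S` matter. -/
def coordEvent (S : Set V) (a : ∀ v, 𝒳 v) : Set (∀ v, 𝒳 v) :=
  {x | ∀ v ∈ S, x v = a v}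

/-- The random vectors `X_A` and `X_D` are independent given `X_M` under `p`:
`P(X_A = a, X_D = d, X_M = m) P(X_M = m) = P(X_A = a, X_M = m) P(X_D = d, X_M = m)`
for all values `a, d, m`. The sets may overlap. -/
def CondIndep (p : (∀ v, 𝒳 v) → ℝ) (A D M : Set V) : Prop :=
  ∀ a d m : ∀ v, 𝒳 v,
    prob p (coordEvent A a ∩ coordEvent D d ∩ coordEvent M m) * prob p (coordEvent M m) =
      prob p (coordEvent A a ∩ coordEvent M m) * prob p (coordEvent D d ∩ coordEvent M m)

end Probability

/-- A class of probability distributions of random vectors `(X_v)_{v ∈ V}`, where each `X_v`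
takes its values in an arbitrary finite set `𝒳 v`. -/
abbrev DistClass (V : Type*) : Type _ :=
  ∀ (𝒳 : V → Type) [∀ v, Fintype (𝒳 v)], ((∀ v, 𝒳 v) → ℝ) → Prop

section Blanket

variable {V : Type*} [Fintype V] [DecidableEq V]

/-- `X_A` is independent from `X_D` given `X_M` for any distribution of the class `𝓕`. -/
def Indep (𝓕 : DistClass V) (A D M : Set V) : Prop :=
  ∀ (𝒳 : V → Type) [∀ v, Fintype (𝒳 v)] (p : (∀ v, 𝒳 v) → ℝ), 𝓕 𝒳 p → CondIndep p A D M

/-- `N` is the Markov blanket of `B` in `C` given `E`: the smallest subset `M` of `C` with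
`X_B` independent from `X_{C \ (B ∪ M)}` given `X_{M ∪ E}` for any distribution of the class,
where smallest means that a subset `M` of `C` has this property if and only if `N ⊆ M`. -/
def IsMarkovBlanket (𝓕 : DistClass V) (B C E N : Set V) : Prop :=
  N ⊆ C ∧ ∀ M ⊆ C, Indep 𝓕 B (C \ (B ∪ M)) (M ∪ E) ↔ N ⊆ M

/-- The Markov blanket of `B` in `C` given `E`, as the intersection of all subsets `M` of `C`
that have the defining independence property (the only set that can satisfy
`IsMarkovBlanket 𝓕 B C E`). -/
def mb (𝓕 : DistClass V) (C B E : Set V) : Set V :=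
  ⋂₀ {M | M ⊆ C ∧ Indep 𝓕 B (C \ (B ∪ M)) (M ∪ E)}

/-- A Markov blanket, when it exists, is `mb`; in particular it is unique. -/
theorem IsMarkovBlanket.eq_mb {𝓕 : DistClass V} {B C E N : Set V}
    (h : IsMarkovBlanket 𝓕 B C E N) : N = mb 𝓕 C B E := by
  apply Set.Subset.antisymm
  · exact Set.subset_sInter fun M hM => (h.2 M hM.1).1 hM.2
  · exact Set.sInter_subset_of_mem ⟨h.1, (h.2 N h.1).2 (Set.Subset.refl N)⟩

end Blanket

section Undirected

variable {V : Type*} [Fintype V] [DecidableEq V]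

/-- `p` is a probability distribution that factorizes as an undirected graphical model on `G`:
`p x = (1 / Z) ∏_{K ∈ 𝒞} ψ_K(x_K)` for a collection `𝒞` of cliques and nonnegative `ψ_K`. -/
def UndirectedFactorizes (G : SimpleGraph V) : DistClass V := fun 𝒳 _ p =>
  p ∈ stdSimplex ℝ (∀ v, 𝒳 v) ∧
    ∃ (𝒞 : Finset (Set V)) (ψ : ∀ K : Set V, (∀ v : K, 𝒳 v) → ℝ) (Z : ℝ),
      (∀ K ∈ 𝒞, G.IsClique K) ∧ (∀ K ∈ 𝒞, ∀ y, 0 ≤ ψ K y) ∧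
        ∀ x, p x = 1 / Z * ∏ K ∈ 𝒞, ψ K (fun v => x v)

/-- `M` separates `X` and `Y`: every path between them (vertices may repeat, endpoints count)
meets `M`. -/
def Separated (G : SimpleGraph V) (X Y M : Set V) : Prop :=
  ∀ x ∈ X, ∀ y ∈ Y, ∀ P : G.Walk x y, ∃ v ∈ P.support, v ∈ M

end Undirected

section Directed

variable {V : Type*} [Fintype V] [DecidableEq V]

/-- The directed graph has no cycle (loops are cycles). -/
def Acyclic (G : Digraph V) : Prop := ∀ v, ¬ Relation.TransGen G.Adj v v

/-- `p` is a probability distribution that factorizes as a directed graphical model on `G`: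
`p x = ∏_v q_v(x_v, x_{prt v})` for conditional distributions `q_v` of `v` given its parents. -/
def DirectedFactorizes (G : Digraph V) : DistClass V := fun 𝒳 _ p =>
  p ∈ stdSimplex ℝ (∀ v, 𝒳 v) ∧
    ∃ q : ∀ v, 𝒳 v → (∀ u : {u // G.Adj u v}, 𝒳 u) → ℝ,
      (∀ v y, (fun a => q v a y) ∈ stdSimplex ℝ (𝒳 v)) ∧
        ∀ x, p x = ∏ v, q v (x v) (fun u => x u)

/-- The sequence `t 0, …, t k` is a trail: consecutive vertices are joined by an arc in one of
the two directions. The values of `t` beyond `k` play no role. -/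
def IsTrail (G : Digraph V) (k : ℕ) (t : ℕ → V) : Prop :=
  ∀ i < k, G.Adj (t i) (t (i + 1)) ∨ G.Adj (t (i + 1)) (t i)

/-- The `i`-th vertex of the trail `t 0, …, t k` is a v-structure. -/
def IsVStructure (G : Digraph V) (k : ℕ) (t : ℕ → V) (i : ℕ) : Prop :=
  0 < i ∧ i < k ∧ G.Adj (t (i - 1)) (t i) ∧ G.Adj (t (i + 1)) (t i)

/-- The trail `t 0, …, t k` is active given `M`: its vertices that are not v-structures
(endpoints included) are not in `M`, and each v-structure is in `M` or has a descendant
in `M`. -/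
def IsActive (G : Digraph V) (k : ℕ) (t : ℕ → V) (M : Set V) : Prop :=
  ∀ i ≤ k, (¬ IsVStructure G k t i → t i ∉ M) ∧
    (IsVStructure G k t i → ∃ m ∈ M, Relation.ReflTransGen G.Adj (t i) m)

/-- `M` d-separates `X` and `Y`: no trail between them is active given `M`. -/
def DSeparated (G : Digraph V) (X Y M : Set V) : Prop :=
  ∀ (k : ℕ) (t : ℕ → V), IsTrail G k t → t 0 ∈ X → t k ∈ Y → ¬ IsActive G k t M

end Directed

end GraphicalModel

open GraphicalModel

/-!
For a fixed `B`, the existence of Markov blankets and the equivalence follow from the fact that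
the independence of `B` and `D` given `M`, for every distribution of the model, is a compositional
graphoid in `D` and `M`. By weak union and intersection, the blanket of `B` in `C` given `E`
consists of the `c ∈ C` that are dependent on `B` given `C \ {c} ∪ E`, and contraction shows that
it is not changed by a `C'` independent of `B` given `C ∪ E`.

The graphoid axioms are evident for separation and d-separation once these are phrased as
reachability along paths that `M` does not block. It remains to identify them with independence.

* Soundness: to see that `A` and `D` are independent given `M`, let `U` be the set of vertices
  outside `M` that are reached from `A`. If each factor of the distribution involves only `U ∪ M` or
  avoids `U`, then exchanging the coordinates in `U` between two independent copies of the random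
  vector shows the independence. In a directed model one first makes the variables that are not
  ancestors of `A ∪ D ∪ M` uniform, which does not change the joint distribution of the others.
* Completeness: in an undirected model, take bits that are equal along the edges outside `M`. In a
  directed model, take bits that travel along a trail that is active given `M`, whose v-structures
  may be assumed to be in `M`; a v-structure has the value `false` only if the bits on its two sides
  agree.
-/

namespace GraphicalModel

section Graphoid

variable {V : Type*}

/-- The compositional graphoid axioms for a relation `I D M`, to be read as the independence of
`B` and `D` given `M` for some fixed `B`. The sets may overlap, so `subset` replaces the usual
disjointness conventions, and composition and decomposition together say that `D` may be treated
one element at a time. -/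
structure IsCompositionalGraphoid (I : Set V → Set V → Prop) : Prop where
  subset : ∀ {D M}, D ⊆ M → I D M
  forall_singleton_iff : ∀ {D M}, (∀ d ∈ D, I {d} M) ↔ I D M
  weak_union : ∀ {D F M}, I F M → I D M → I D (M ∪ F)
  intersection : ∀ {D F M}, (∀ f ∈ F, I {f} (M ∪ F \ {f})) → I D (M ∪ F) → I D M

namespace IsCompositionalGraphoid

variable {I : Set V → Set V → Prop} {D D' F M : Set V}

theorem mono (h : IsCompositionalGraphoid I) (hD : D ⊆ D') (hI : I D' M) : I D M :=
  h.forall_singleton_iff.1 fun d hd => h.forall_singleton_iff.2 hI d (hD hd)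

theorem union (h : IsCompositionalGraphoid I) (hD : I D M) (hD' : I D' M) : I (D ∪ D') M :=
  h.forall_singleton_iff.1 fun d hd =>
    hd.elim (h.forall_singleton_iff.2 hD d) (h.forall_singleton_iff.2 hD' d)

theorem sdiff_iff (h : IsCompositionalGraphoid I) (hF : D ∩ F ⊆ M) : I (D \ F) M ↔ I D M :=
  ⟨fun hI => Set.sdiff_union_inter D F ▸ h.union hI (h.subset hF), h.mono Set.sdiff_subset⟩

theorem contraction (h : IsCompositionalGraphoid I) (hF : I F M) (hD : I D (M ∪ F)) : I D M :=
  h.intersection (fun _ hf => h.weak_union (h.mono Set.sdiff_subset hF)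
    (h.mono (Set.singleton_subset_iff.2 hf) hF)) hD

end IsCompositionalGraphoid

end Graphoid

section Blanket

variable {V : Type*} [Fintype V] [DecidableEq V] {𝓕 : DistClass V} {A B C C' D E M : Set V}

theorem indep_comm : Indep 𝓕 A D M ↔ Indep 𝓕 D A M := by
  have symm {A D : Set V} (h : Indep 𝓕 A D M) : Indep 𝓕 D A M := fun 𝒳 _ p hp a d m => by
    rw [Set.inter_comm (coordEvent D a), h 𝒳 p hp d a m, mul_comm]
  exact ⟨symm, symm⟩

namespace IsCompositionalGraphoid

theorem indep_sdiff_union_iff (h : IsCompositionalGraphoid (Indep 𝓕 B)) (hB : B ∩ C ⊆ E) :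
    Indep 𝓕 B (C \ (B ∪ M)) (M ∪ E) ↔ Indep 𝓕 B C (M ∪ E) := by
  refine h.sdiff_iff ?_
  rintro v ⟨hvC, hvB | hvM⟩
  exacts [Or.inr (hB ⟨hvB, hvC⟩), Or.inl hvM]

theorem indep_iff_subset (h : IsCompositionalGraphoid (Indep 𝓕 B)) (hM : M ⊆ C) :
    Indep 𝓕 B C (M ∪ E) ↔ {c ∈ C | ¬ Indep 𝓕 B {c} (C \ {c} ∪ E)} ⊆ M := by
  have union_sdiff {c : V} (hc : c ∉ M) : M ∪ E ∪ C \ {c} = C \ {c} ∪ E := by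
    rw [Set.union_right_comm, Set.union_eq_right.2 (Set.subset_sdiff_singleton hM hc)]
  constructor
  · rintro hI c ⟨hcC, hdep⟩
    by_contra hcM
    refine hdep (union_sdiff hcM ▸ h.weak_union ?_ ?_)
    exacts [h.mono Set.sdiff_subset hI, h.mono (Set.singleton_subset_iff.2 hcC) hI]
  · intro hN
    refine h.intersection (F := C) (fun c hcC => ?_) (h.subset Set.subset_union_right)
    by_cases hcM : c ∈ M
    · exact h.subset (Set.singleton_subset_iff.2 (Or.inl (Or.inl hcM)))
    · rw [union_sdiff hcM]
      exact by_contra fun hdep => hcM (hN ⟨hcC, hdep⟩)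

theorem isMarkovBlanket (h : IsCompositionalGraphoid (Indep 𝓕 B)) (hB : B ∩ C ⊆ E) :
    IsMarkovBlanket 𝓕 B C E (mb 𝓕 C B E) := by
  have hN : IsMarkovBlanket 𝓕 B C E {c ∈ C | ¬ Indep 𝓕 B {c} (C \ {c} ∪ E)} := by
    refine ⟨Set.sep_subset _ _, fun M hM => ?_⟩
    rw [h.indep_sdiff_union_iff hB, h.indep_iff_subset hM]
  exact hN.eq_mb ▸ hN

theorem mb_subset_iff (h : IsCompositionalGraphoid (Indep 𝓕 B)) (hB : B ∩ C ⊆ E)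
    (hM : M ⊆ C) : mb 𝓕 C B E ⊆ M ↔ Indep 𝓕 B C (M ∪ E) := by
  rw [← (h.isMarkovBlanket hB).2 M hM, h.indep_sdiff_union_iff hB]

theorem mb_union_eq_iff (h : IsCompositionalGraphoid (Indep 𝓕 B))
    (hB : B ∩ (C ∪ C') ⊆ E) :
    mb 𝓕 (C ∪ C') B E = mb 𝓕 C B E ↔ Indep 𝓕 B C' (C ∪ E) := by
  have hBC : B ∩ C ⊆ E := fun v hv => hB ⟨hv.1, Or.inl hv.2⟩
  have mb_subset : mb 𝓕 C B E ⊆ C := (h.isMarkovBlanket hBC).1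
  constructor
  · intro heq
    exact h.mono Set.subset_union_right
      ((h.mb_subset_iff hB Set.subset_union_left).1 (heq.trans_subset mb_subset))
  · intro hC'
    have hC : Indep 𝓕 B C (mb 𝓕 C B E ∪ E) := (h.mb_subset_iff hBC mb_subset).1 subset_rfl
    have union_eq : mb 𝓕 C B E ∪ E ∪ C = C ∪ E := by
      rw [Set.union_right_comm, Set.union_eq_right.2 mb_subset]
    have hsub : mb 𝓕 (C ∪ C') B E ⊆ mb 𝓕 C B E :=
      (h.mb_subset_iff hB (mb_subset.trans Set.subset_union_left)).2
        (h.union hC (h.contraction hC (union_eq ▸ hC')))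
    refine hsub.antisymm ((h.mb_subset_iff hBC (hsub.trans mb_subset)).2 ?_)
    exact h.mono Set.subset_union_left
      ((h.mb_subset_iff hB (h.isMarkovBlanket hB).1).1 subset_rfl)

end IsCompositionalGraphoid

end Blanket

section Coordinates

variable {ι α : Type*} {𝒳 : ι → Type*}

theorem dependsOn_mem_inter {S T : Set (∀ i, 𝒳 i)} {W : Set ι} (hS : DependsOn (· ∈ S) W)
    (hT : DependsOn (· ∈ T) W) : DependsOn (· ∈ S ∩ T) W :=
  fun _ _ hxy => congrArg₂ And (hS hxy) (hT hxy)

theorem dependsOn_indicator [Zero α] {S : Set (∀ i, 𝒳 i)} {f : (∀ i, 𝒳 i) → α} {W : Set ι}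
    (hS : DependsOn (· ∈ S) W) (hf : DependsOn f W) : DependsOn (S.indicator f) W := by
  classical
  intro x y hxy
  have hmem : x ∈ S ↔ y ∈ S := Eq.to_iff (hS hxy)
  simp only [Set.indicator_apply, hmem, hf hxy]

theorem dependsOn_finset_prod [CommMonoid α] {κ : Type*} {s : Finset κ}
    {f : κ → (∀ i, 𝒳 i) → α} {W : Set ι} (hf : ∀ k ∈ s, DependsOn (f k) W) :
    DependsOn (fun x => ∏ k ∈ s, f k x) W :=
  fun _ _ hxy => Finset.prod_congr rfl fun k hk => hf k hk hxy

/-- Exchange of the coordinates in `U` between two configurations. -/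
noncomputable def swapOn (U : Set ι) (z : (∀ i, 𝒳 i) × (∀ i, 𝒳 i)) :
    (∀ i, 𝒳 i) × (∀ i, 𝒳 i) :=
  open scoped Classical in (U.piecewise z.2 z.1, U.piecewise z.1 z.2)

theorem swapOn_involutive (U : Set ι) :
    Function.Involutive (swapOn U : (∀ i, 𝒳 i) × (∀ i, 𝒳 i) → _) := by
  rintro ⟨x, y⟩
  ext i <;> by_cases hi : i ∈ U <;> simp [swapOn, hi]

end Coordinates

section Probability

variable {V : Type*} {𝒳 : V → Type} {A D M U W : Set V}

theorem dependsOn_mem_coordEvent (S : Set V) (a : ∀ v, 𝒳 v) : DependsOn (· ∈ coordEvent S a) S :=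
  fun _ _ hxy => propext (forall₂_congr fun v hv => by rw [hxy v hv])

variable [Fintype V] [DecidableEq V] [∀ v, Fintype (𝒳 v)] {p p' : (∀ v, 𝒳 v) → ℝ}

theorem prob_inter (p : (∀ v, 𝒳 v) → ℝ) (S T : Set (∀ v, 𝒳 v)) :
    prob p (S ∩ T) = prob (S.indicator p) T := by
  rw [prob, prob, Set.indicator_indicator, Set.inter_comm]

theorem prob_mul_prob_exchange {f f' g g' : (∀ v, 𝒳 v) → ℝ} (hMU : Disjoint M U)
    (hf : DependsOn f (U ∪ M)) (hf' : DependsOn f' (U ∪ M)) (hg : DependsOn g Uᶜ)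
    (hg' : DependsOn g' Uᶜ) (m : ∀ v, 𝒳 v) :
    prob (f * g) (coordEvent M m) * prob (f' * g') (coordEvent M m) =
      prob (f' * g) (coordEvent M m) * prob (f * g') (coordEvent M m) := by
  classical
  simp only [prob, Finset.sum_mul_sum, ← Finset.sum_product', Finset.univ_product_univ]
  refine Fintype.sum_equiv (swapOn_involutive U).toPerm _ _ fun ⟨x, y⟩ => ?_
  change _ = (coordEvent M m).indicator (f' * g) (U.piecewise y x) *
    (coordEvent M m).indicator (f * g') (U.piecewise x y)
  have piecewise_eq {x y : ∀ v, 𝒳 v} : ∀ v ∈ Uᶜ, U.piecewise x y v = y v := fun v hv =>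
    Set.piecewise_eq_of_notMem _ _ _ hv
  have mem_iff {x y : ∀ v, 𝒳 v} : U.piecewise x y ∈ coordEvent M m ↔ y ∈ coordEvent M m :=
    forall₂_congr fun v hv => by rw [piecewise_eq v (hMU.notMem_of_mem_left hv)]
  by_cases hx : x ∈ coordEvent M m
  swap
  · simp [hx, mem_iff]
  by_cases hy : y ∈ coordEvent M m
  swap
  · simp [hy, mem_iff]
  have eq_piecewise {x y : ∀ v, 𝒳 v} (hx : x ∈ coordEvent M m) (hy : y ∈ coordEvent M m) :
      ∀ v ∈ U ∪ M, U.piecewise x y v = x v := by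
    intro v hv
    by_cases hvU : v ∈ U
    · exact Set.piecewise_eq_of_mem _ _ _ hvU
    · have hvM : v ∈ M := hv.resolve_left hvU
      rw [piecewise_eq v hvU, hx v hvM, hy v hvM]
  simp only [Set.indicator_of_mem, hx, hy, mem_iff, Pi.mul_apply, hf (eq_piecewise hx hy),
    hf' (eq_piecewise hy hx), hg piecewise_eq, hg' piecewise_eq]
  ring

theorem condIndep_of_eq_mul {f g : (∀ v, 𝒳 v) → ℝ} (hp : p = f * g)
    (hf : DependsOn f (U ∪ M)) (hg : DependsOn g Uᶜ) (hA : A ⊆ U ∪ M) (hDU : Disjoint D U)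
    (hMU : Disjoint M U) : CondIndep p A D M := by
  intro a d m
  have hA' : DependsOn (· ∈ coordEvent A a) (U ∪ M) := (dependsOn_mem_coordEvent A a).mono hA
  have hD' : DependsOn (· ∈ coordEvent D d) Uᶜ :=
    (dependsOn_mem_coordEvent D d).mono hDU.subset_compl_right
  have hAD : ((coordEvent A a ∩ coordEvent D d).indicator (f * g)) =
      (coordEvent A a).indicator f * (coordEvent D d).indicator g :=
    funext fun x => Set.inter_indicator_mul f g x
  have hA_left : (coordEvent A a).indicator (f * g) = (coordEvent A a).indicator f * g :=
    funext fun x => Set.indicator_mul_left _ f g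
  have hD_right : (coordEvent D d).indicator (f * g) = f * (coordEvent D d).indicator g :=
    funext fun x => Set.indicator_mul_right _ f g
  rw [hp, prob_inter _ (_ ∩ _), prob_inter, prob_inter, hAD, hA_left, hD_right,
    prob_mul_prob_exchange hMU (dependsOn_indicator hA' hf) hf (dependsOn_indicator hD' hg) hg,
    mul_comm]

theorem condIndep_of_eq_prod {κ : Type*} {s : Finset κ} {r : κ → (∀ v, 𝒳 v) → ℝ}
    {scope : κ → Set V} (c : ℝ) (hp : ∀ x, p x = c * ∏ k ∈ s, r k x)
    (hr : ∀ k ∈ s, DependsOn (r k) (scope k))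
    (hscope : ∀ k ∈ s, scope k ⊆ U ∪ M ∨ Disjoint (scope k) U)
    (hA : A ⊆ U ∪ M) (hDU : Disjoint D U) (hMU : Disjoint M U) : CondIndep p A D M := by
  classical
  let f : (∀ v, 𝒳 v) → ℝ := fun x => ∏ k ∈ s with scope k ⊆ U ∪ M, r k x
  let g : (∀ v, 𝒳 v) → ℝ := fun x => ∏ k ∈ s with ¬ scope k ⊆ U ∪ M, r k x
  have hf : DependsOn f (U ∪ M) := dependsOn_finset_prod fun k hk =>
    (hr k (Finset.mem_filter.1 hk).1).mono (Finset.mem_filter.1 hk).2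
  have hg : DependsOn g Uᶜ := dependsOn_finset_prod fun k hk => by
    obtain ⟨hks, hk⟩ := Finset.mem_filter.1 hk
    exact (hr k hks).mono ((hscope k hks).resolve_left hk).subset_compl_right
  refine condIndep_of_eq_mul (f := fun x => c * f x) (g := g) (funext fun x => ?_)
    (fun x y hxy => congrArg (c * ·) (hf hxy)) hg hA hDU hMU
  rw [hp, Pi.mul_apply, mul_assoc, Finset.prod_filter_mul_prod_filter_not]

theorem prob_ne_zero_iff (hp : ∀ x, 0 ≤ p x) {S : Set (∀ v, 𝒳 v)} :
    prob p S ≠ 0 ↔ ∃ x ∈ S, p x ≠ 0 := by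
  have indicator_nonneg (x) : 0 ≤ S.indicator p x := Set.indicator_nonneg (fun x _ => hp x) x
  rw [prob, Ne, Finset.sum_eq_zero_iff_of_nonneg fun x _ => indicator_nonneg x]
  simp only [Finset.mem_univ, true_implies, not_forall, Set.indicator_apply_eq_zero, exists_prop]

theorem CondIndep.exists_ne_zero (h : CondIndep p A D M) (hp : ∀ x, 0 ≤ p x) {x y : ∀ v, 𝒳 v}
    (hx : p x ≠ 0) (hy : p y ≠ 0) (hxy : ∀ v ∈ M, x v = y v) :
    ∃ z, p z ≠ 0 ∧ (∀ v ∈ A, z v = x v) ∧ (∀ v ∈ D, z v = y v) ∧ ∀ v ∈ M, z v = y v := by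
  have hAM : prob p (coordEvent A x ∩ coordEvent M y) ≠ 0 :=
    (prob_ne_zero_iff hp).2 ⟨x, ⟨fun _ _ => rfl, hxy⟩, hx⟩
  have hDM : prob p (coordEvent D y ∩ coordEvent M y) ≠ 0 :=
    (prob_ne_zero_iff hp).2 ⟨y, ⟨fun _ _ => rfl, fun _ _ => rfl⟩, hy⟩
  obtain ⟨z, ⟨⟨hzA, hzD⟩, hzM⟩, hz⟩ :=
    (prob_ne_zero_iff hp).1 (left_ne_zero_of_mul (h x y y ▸ mul_ne_zero hAM hDM))
  exact ⟨z, hz, hzA, hzD, hzM⟩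

/-- The random vector `X_W` has the same distribution under `p` and `p'`. -/
def MarginalEq (W : Set V) (p p' : (∀ v, 𝒳 v) → ℝ) : Prop :=
  ∀ S : Set (∀ v, 𝒳 v), DependsOn (· ∈ S) W → prob p S = prob p' S

theorem CondIndep.of_marginalEq (h : CondIndep p' A D M) (hpp' : MarginalEq W p p') (hA : A ⊆ W)
    (hD : D ⊆ W) (hM : M ⊆ W) : CondIndep p A D M := by
  intro a d m
  have hA' : DependsOn (· ∈ coordEvent A a) W := (dependsOn_mem_coordEvent A a).mono hA
  have hD' : DependsOn (· ∈ coordEvent D d) W := (dependsOn_mem_coordEvent D d).mono hD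
  have hM' : DependsOn (· ∈ coordEvent M m) W := (dependsOn_mem_coordEvent M m).mono hM
  rw [hpp' _ (dependsOn_mem_inter (dependsOn_mem_inter hA' hD') hM'), hpp' _ hM',
    hpp' _ (dependsOn_mem_inter hA' hM'), hpp' _ (dependsOn_mem_inter hD' hM'), h a d m]

theorem sum_sum_update (v : V) (F : (∀ v, 𝒳 v) → ℝ) :
    ∑ x, ∑ a, F (Function.update x v a) = Fintype.card (𝒳 v) * ∑ x, F x := by
  have hinv : Function.Involutive fun z : (∀ v, 𝒳 v) × 𝒳 v =>
      (Function.update z.1 v z.2, z.1 v) := fun ⟨x, a⟩ => by simp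
  calc ∑ x, ∑ a, F (Function.update x v a)
      = ∑ z : (∀ v, 𝒳 v) × 𝒳 v, F (Function.update z.1 v z.2) := by rw [Fintype.sum_prod_type]
    _ = ∑ z : (∀ v, 𝒳 v) × 𝒳 v, F z.1 := Fintype.sum_equiv hinv.toPerm _ _ fun _ => rfl
    _ = Fintype.card (𝒳 v) * ∑ x, F x := by
      simp [Fintype.sum_prod_type, Finset.mul_sum]

theorem sum_mul_eq_sum_mul_inv_card {v : V} [Nonempty (𝒳 v)] {F Q : (∀ v, 𝒳 v) → ℝ}
    (hF : DependsOn F {v}ᶜ) (hQ : ∀ x, ∑ a, Q (Function.update x v a) = 1) :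
    ∑ x, F x * Q x = ∑ x, F x * (Fintype.card (𝒳 v) : ℝ)⁻¹ := by
  have hcard : (Fintype.card (𝒳 v) : ℝ) ≠ 0 := Nat.cast_ne_zero.2 Fintype.card_ne_zero
  have hF_update (x : ∀ v, 𝒳 v) (a : 𝒳 v) : F (Function.update x v a) = F x :=
    hF fun u hu => Function.update_of_ne hu _ _
  have hsum := sum_sum_update v fun x => F x * Q x
  simp only [hF_update, ← Finset.mul_sum, hQ, mul_one] at hsum
  rw [← Finset.sum_mul, hsum]
  field_simp

end Probability

section Undirected

variable {V : Type*} {G : SimpleGraph V} {A D F M : Set V} {v w : V}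

/-- The vertices reached from `A` by a walk along which no vertex is in `M`, except possibly
the last one. -/
inductive Reach (G : SimpleGraph V) (A M : Set V) : V → Prop
  | start {a : V} (ha : a ∈ A) : Reach G A M a
  | step {v w : V} (hv : Reach G A M v) (hvM : v ∉ M) (hvw : G.Adj v w) : Reach G A M w

namespace Reach

theorem antitone {M' : Set V} (hM : M ⊆ M') (h : Reach G A M' v) : Reach G A M v := by
  induction h with
  | start ha => exact start ha
  | step _ hvM hvw ih => exact step ih (fun hv => hvM (hM hv)) hvw

theorem exists_walk (h : Reach G A M v) (hv : v ∉ M) :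
    ∃ a ∈ A, ∃ P : G.Walk a v, ∀ u ∈ P.support, u ∉ M := by
  induction h with
  | start ha => exact ⟨_, ha, .nil, by simpa using hv⟩
  | step _ huM huv ih =>
    obtain ⟨a, ha, P, hP⟩ := ih huM
    refine ⟨a, ha, P.concat huv, fun w hw => ?_⟩
    rw [SimpleGraph.Walk.support_concat, List.mem_append, List.mem_singleton] at hw
    rcases hw with hw | rfl
    exacts [hP w hw, hv]

theorem of_walk (h : Reach G A M v) (P : G.Walk v w) (hP : ∀ u ∈ P.support, u ∉ M) :
    Reach G A M w := by
  induction P with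
  | nil => exact h
  | cons hadj P ih =>
    rw [SimpleGraph.Walk.support_cons, List.forall_mem_cons] at hP
    exact ih (h.step hP.1 hadj) hP.2

theorem exists_mem_or_union (h : Reach G A M v) :
    (∃ f ∈ F, f ∉ M ∧ Reach G A (M ∪ F \ {f}) f) ∨ Reach G A (M ∪ F) v := by
  induction h with
  | start ha => exact Or.inr (start ha)
  | @step v _ _ hvM hvw ih =>
    rcases ih with hF | hv
    · exact Or.inl hF
    by_cases hvF : v ∈ F
    · have hsub : M ∪ F \ {v} ⊆ M ∪ F := Set.union_subset_union_right M Set.sdiff_subset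
      exact Or.inl ⟨v, hvF, hvM, hv.antitone hsub⟩
    · exact Or.inr (hv.step (not_or.2 ⟨hvM, hvF⟩) hvw)

end Reach

theorem separated_iff : Separated G A D M ↔ ∀ d ∈ D, d ∉ M → ¬ Reach G A M d := by
  constructor
  · intro h d hd hdM hreach
    obtain ⟨a, ha, P, hP⟩ := hreach.exists_walk hdM
    obtain ⟨v, hv, hvM⟩ := h a ha d hd P
    exact hP v hv hvM
  · intro h a ha d hd P
    by_contra! hP
    exact h d hd (hP d P.end_mem_support) ((Reach.start ha).of_walk P hP)

theorem isCompositionalGraphoid_separated (G : SimpleGraph V) (A : Set V) :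
    IsCompositionalGraphoid (Separated G A) where
  subset h := separated_iff.2 fun _ hd hdM => (hdM (h hd)).elim
  forall_singleton_iff := by simp [separated_iff]
  weak_union _ hD := separated_iff.2 fun d hd hdMF hreach =>
    separated_iff.1 hD d hd (fun hdM => hdMF (Or.inl hdM)) (hreach.antitone Set.subset_union_left)
  intersection {D F M} hF hD := separated_iff.2 fun d hd hdM hreach => by
    have not_reach_mem {f} (hf : f ∈ F) (hfM : f ∉ M) : ¬ Reach G A (M ∪ F \ {f}) f :=
      separated_iff.1 (hF f hf) f rfl (by simp [hfM])
    rcases hreach.exists_mem_or_union with ⟨f, hf, hfM, hreach⟩ | hreach'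
    · exact not_reach_mem hf hfM hreach
    by_cases hdF : d ∈ F
    · have hsub : M ∪ F \ {d} ⊆ M ∪ F := Set.union_subset_union_right M Set.sdiff_subset
      exact not_reach_mem hdF hdM (hreach'.antitone hsub)
    · exact separated_iff.1 hD d hd (not_or.2 ⟨hdM, hdF⟩) hreach'

variable [Fintype V] [DecidableEq V]

section Factorization

variable {𝒳 : V → Type} [∀ v, Fintype (𝒳 v)] {p : (∀ v, 𝒳 v) → ℝ}

theorem UndirectedFactorizes.condIndep (hp : UndirectedFactorizes G 𝒳 p)
    (hsep : Separated G A D M) : CondIndep p A D M := by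
  obtain ⟨-, 𝒞, ψ, Z, hclique, -, hψ⟩ := hp
  refine condIndep_of_eq_prod (U := {v | v ∉ M ∧ Reach G A M v}) (scope := id) (1 / Z) hψ
    (fun K _ x y hxy => congrArg (ψ K) (funext fun v => hxy v v.2)) (fun K hK => ?_)
    (fun a ha => ?_) ?_ ?_
  · refine or_iff_not_imp_right.2 fun hmeet w hw => ?_
    obtain ⟨v, hvK, hvM, hv⟩ := Set.not_disjoint_iff.1 hmeet
    by_cases hwM : w ∈ M
    · exact Or.inr hwM
    · rcases eq_or_ne v w with rfl | hvw
      exacts [Or.inl ⟨hvM, hv⟩, Or.inl ⟨hwM, hv.step hvM (hclique K hK hvK hw hvw)⟩]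
  · exact (em (a ∈ M)).elim Or.inr fun haM => Or.inl ⟨haM, .start ha⟩
  · exact Set.disjoint_left.2 fun d hd hdU => separated_iff.1 hsep d hd hdU.1 hdU.2
  · exact Set.disjoint_left.2 fun v hvM hvU => hvU.1 hvM

theorem exists_undirectedFactorizes_support (G : SimpleGraph V)
    (R : ∀ K : Set V, (∀ v : K, 𝒳 v) → Prop)
    (hR : ∃ x : ∀ v, 𝒳 v, ∀ K, G.IsClique K → R K fun v => x v) :
    ∃ p, UndirectedFactorizes G 𝒳 p ∧
      ∀ x, p x ≠ 0 ↔ ∀ K, G.IsClique K → R K fun v => x v := by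
  classical
  let 𝒞 : Finset (Set V) := {K | G.IsClique K}
  let s : Finset (∀ v, 𝒳 v) := {x | ∀ K, G.IsClique K → R K fun v => x v}
  have hs (x) : x ∈ s ↔ ∀ K, G.IsClique K → R K fun v => x v := by simp [s]
  have hcard : (s.card : ℝ) ≠ 0 :=
    Nat.cast_ne_zero.2 (Finset.card_ne_zero.2 (hR.imp fun x hx => (hs x).2 hx))
  let p : (∀ v, 𝒳 v) → ℝ := fun x => if x ∈ s then 1 / (s.card : ℝ) else 0
  refine ⟨p, ⟨⟨fun x => by positivity, ?_⟩, 𝒞, fun K y => if R K y then 1 else 0, s.card, ?_, ?_,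
    fun x => ?_⟩, fun x => ?_⟩
  · simp [p, hcard]
  · simp [𝒞]
  · exact fun K _ y => by positivity
  · have hx : x ∈ s ↔ ∀ K ∈ 𝒞, R K fun v => x v := by simp [hs, 𝒞]
    simp [p, Finset.prod_ite_zero, hx]
  · simp [p, hs, hcard]

end Factorization

theorem separated_of_indep (h : Indep (UndirectedFactorizes G) A D M) : Separated G A D M := by
  refine separated_iff.2 fun d hd hdM hreach => ?_
  let R (K : Set V) (y : K → Bool) : Prop :=
    ∀ u w : K, (u : V) ∉ M → (w : V) ∉ M → y u = y w
  classical
  obtain ⟨p, hp, hsupp⟩ := exists_undirectedFactorizes_support (𝒳 := fun _ => Bool) G R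
    ⟨fun _ => false, fun _ _ _ _ _ _ => rfl⟩
  have hx : p (fun v => decide (v ∉ M)) ≠ 0 :=
    (hsupp _).2 fun K _ u w hu hw => by simp [hu, hw]
  have hy : p (fun _ => false) ≠ 0 := (hsupp _).2 fun _ _ _ _ _ _ => rfl
  obtain ⟨z, hz, hzA, hzD, -⟩ := (h _ p hp).exists_ne_zero hp.1.1 hx hy (by simp)
  have z_eq_of_adj {v w} (hv : v ∉ M) (hw : w ∉ M) (hvw : G.Adj v w) : z v = z w :=
    (hsupp z).1 hz {v, w} (by simp [hvw]) ⟨v, by simp⟩ ⟨w, by simp⟩ hv hw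
  have z_eq_true {v} (hv : Reach G A M v) : v ∉ M → z v = true := by
    induction hv with
    | start ha => exact fun haM => by simp [hzA _ ha, haM]
    | step _ hvM hvw ih => exact fun hwM => z_eq_of_adj hvM hwM hvw ▸ ih hvM
  exact Bool.false_ne_true ((hzD d hd).symm.trans (z_eq_true hreach hdM))

theorem indep_undirectedFactorizes_iff :
    Indep (UndirectedFactorizes G) A D M ↔ Separated G A D M :=
  ⟨separated_of_indep, fun hsep _ _ _ hp => hp.condIndep hsep⟩

theorem isCompositionalGraphoid_indep_undirectedFactorizes (G : SimpleGraph V) (A : Set V) :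
    IsCompositionalGraphoid (Indep (UndirectedFactorizes G) A) := by
  have h : Indep (UndirectedFactorizes G) A = Separated G A :=
    funext₂ fun _ _ => propext indep_undirectedFactorizes_iff
  exact h ▸ isCompositionalGraphoid_separated G A

end Undirected

section BayesBall

variable {V : Type*} {G : Digraph V} {A F M : Set V}

/-- The direction in which a trail arrives at a vertex: `down` along the last arc, `up` against
it. A trail without arcs counts as arriving `up`. -/
inductive Heading
  | up
  | down

/-- `BayesBall G A M s v` says that a trail from `A` arrives at `v` with heading `s`, where each
vertex before `v` is in `M` exactly when it is a v-structure. Thus a ball may always leave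
downwards from a vertex outside `M`, while it leaves upwards either from a vertex outside `M` that
it reached upwards, or from a vertex of `M` that it reached downwards. -/
inductive BayesBall (G : Digraph V) (A M : Set V) : Heading → V → Prop
  | start {a : V} (ha : a ∈ A) : BayesBall G A M .up a
  | down {s : Heading} {v w : V} (hv : BayesBall G A M s v) (hvM : v ∉ M) (hvw : G.Adj v w) :
    BayesBall G A M .down w
  | up {s : Heading} {u v : V} (hv : BayesBall G A M s v) (hvM : s = .down ↔ v ∈ M)
    (huv : G.Adj u v) : BayesBall G A M .up u

/-- `d` is outside `M` and is reached from `A` by a trail that is active given `M`. -/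
def DConnected (G : Digraph V) (A M : Set V) (d : V) : Prop :=
  d ∉ M ∧ ∃ s, BayesBall G A M s d

theorem BayesBall.of_union {s : Heading} {v : V} (h : BayesBall G A (M ∪ F) s v) :
    BayesBall G A M s v ∨ ∃ f ∈ F, DConnected G A M f := by
  induction h with
  | start ha => exact Or.inl (start ha)
  | down _ hvM hvw ih => exact ih.imp_left fun h => h.down (fun hv => hvM (Or.inl hv)) hvw
  | @up s u v _ hvM huv ih =>
    rcases ih with h | hF
    · by_cases hvF : v ∈ F ∧ v ∉ M
      · exact Or.inr ⟨v, hvF.1, hvF.2, s, h⟩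
      · refine Or.inl (h.up (hvM.trans ⟨fun hv => ?_, Or.inl⟩) huv)
        exact hv.elim id fun hv => by_contra fun hvM => hvF ⟨hv, hvM⟩
    · exact Or.inr hF

theorem DConnected.of_union {d : V} (h : DConnected G A (M ∪ F) d) :
    DConnected G A M d ∨ ∃ f ∈ F, DConnected G A M f := by
  obtain ⟨hdM, s, hs⟩ := h
  exact hs.of_union.imp_left fun hs => ⟨fun hd => hdM (Or.inl hd), s, hs⟩

theorem BayesBall.dconnected_union_sdiff {s : Heading} {f : V} (h : BayesBall G A (M ∪ F) s f)
    (hf : f ∈ F) (hfM : f ∉ M) : DConnected G A (M ∪ F \ {f}) f := by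
  have union_eq : M ∪ F = (M ∪ F \ {f}) ∪ {f} := by
    rw [Set.union_assoc, Set.sdiff_union_of_subset (Set.singleton_subset_iff.2 hf)]
  rcases (union_eq ▸ h).of_union with h | ⟨_, rfl, h⟩
  · exact ⟨by simp [hfM], s, h⟩
  · exact h

theorem BayesBall.exists_mem_or_union (F : Set V) {s : Heading} {v : V}
    (h : BayesBall G A M s v) :
    (∃ f ∈ F, DConnected G A (M ∪ F \ {f}) f) ∨ BayesBall G A (M ∪ F) s v := by
  have of_mem {s v} (h : BayesBall G A (M ∪ F) s v) (hv : v ∈ F ∧ v ∉ M) :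
      ∃ f ∈ F, DConnected G A (M ∪ F \ {f}) f :=
    ⟨v, hv.1, h.dconnected_union_sdiff hv.1 hv.2⟩
  induction h with
  | start ha => exact Or.inr (start ha)
  | @down s v w _ hvM hvw ih =>
    rcases ih with hF | h
    · exact Or.inl hF
    by_cases hv : v ∈ F
    · exact Or.inl (of_mem h ⟨hv, hvM⟩)
    · exact Or.inr (h.down (not_or.2 ⟨hvM, hv⟩) hvw)
  | @up s u v _ hvM huv ih =>
    rcases ih with hF | h
    · exact Or.inl hF
    by_cases hv : v ∈ F ∧ v ∉ M
    · exact Or.inl (of_mem h hv)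
    · refine Or.inr (h.up (hvM.trans ⟨Or.inl, fun hvMF => ?_⟩) huv)
      exact hvMF.elim id fun hvF => by_contra fun hvM => hv ⟨hvF, hvM⟩

theorem DConnected.exists_mem_or_union (F : Set V) {d : V} (h : DConnected G A M d) :
    (∃ f ∈ F, DConnected G A (M ∪ F \ {f}) f) ∨ DConnected G A (M ∪ F) d := by
  obtain ⟨hdM, s, hs⟩ := h
  rcases hs.exists_mem_or_union F with hF | hs
  · exact Or.inl hF
  by_cases hdF : d ∈ F
  · exact Or.inl ⟨d, hdF, hs.dconnected_union_sdiff hdF hdM⟩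
  · exact Or.inr ⟨not_or.2 ⟨hdM, hdF⟩, s, hs⟩

theorem isCompositionalGraphoid_dconnected (G : Digraph V) (A : Set V) :
    IsCompositionalGraphoid fun D M => ∀ d ∈ D, ¬ DConnected G A M d where
  subset h _ hd hconn := hconn.1 (h hd)
  forall_singleton_iff := by simp
  weak_union hF hD d hd hconn :=
    hconn.of_union.elim (hD d hd) fun ⟨f, hf, hconn⟩ => hF f hf hconn
  intersection {_ F _} hF hD d hd hconn :=
    (hconn.exists_mem_or_union F).elim (fun ⟨f, hf, hconn⟩ => hF f hf f rfl hconn) (hD d hd)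

/-- The ball runs down towards `z`, and bounces back at the first vertex in `M`, or at `z`. -/
theorem BayesBall.up_of_reflTransGen {v z : V} (hvz : Relation.ReflTransGen G.Adj v z)
    (hz : z ∉ M → BayesBall G A M .down z → BayesBall G A M .up z) (hv : v ∉ M)
    (h : BayesBall G A M .down v) : BayesBall G A M .up v := by
  induction hvz using Relation.ReflTransGen.head_induction_on with
  | refl => exact hz hv h
  | @head v w hvw _ ih =>
    have hw : BayesBall G A M .down w := h.down hv hvw
    by_cases hwM : w ∈ M
    · exact hw.up (iff_of_true rfl hwM) hvw
    · exact (ih hwM hw).up (iff_of_false nofun hwM) hvw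

end BayesBall

section Trail

variable {V : Type*} {G : Digraph V} {A D M : Set V} {t : ℕ → V} {i j k : ℕ}

theorem Acyclic.asymm (hG : Acyclic G) {u v : V} (huv : G.Adj u v) : ¬ G.Adj v u :=
  fun hvu => hG u (.tail (.single huv) hvu)

/-- The heading with which the trail `t 0, t 1, …` arrives at its `i`-th vertex. -/
noncomputable def heading (G : Digraph V) (t : ℕ → V) (i : ℕ) : Heading :=
  open scoped Classical in if 0 < i ∧ G.Adj (t (i - 1)) (t i) then .down else .up

theorem heading_zero : heading G t 0 = .up := if_neg (by simp)

theorem heading_succ_of_adj (h : G.Adj (t i) (t (i + 1))) : heading G t (i + 1) = .down :=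
  if_pos ⟨i.succ_pos, h⟩

theorem heading_succ_of_adj_symm (hG : Acyclic G) (h : G.Adj (t (i + 1)) (t i)) :
    heading G t (i + 1) = .up :=
  if_neg fun h' => hG.asymm h h'.2

theorem isVStructure_iff :
    IsVStructure G k t i ↔ i < k ∧ heading G t i = .down ∧ G.Adj (t (i + 1)) (t i) := by
  simp only [IsVStructure, heading, ite_eq_left_iff, reduceCtorEq, imp_false, not_not]
  tauto

theorem not_isVStructure_of_adj (hG : Acyclic G) (hij : i + 1 = j ∨ j + 1 = i)
    (h : G.Adj (t i) (t j)) : ¬ IsVStructure G k t i := by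
  rintro ⟨-, -, hpred, hsucc⟩
  rcases hij with rfl | rfl
  exacts [hG.asymm h hsucc, hG.asymm h hpred]

/-- The trail `t 0, …, t k` starts in `A`, and each vertex before `t k` is in `M` exactly when it
is a v-structure. -/
def IsOpenTrail (G : Digraph V) (A M : Set V) (k : ℕ) (t : ℕ → V) : Prop :=
  IsTrail G k t ∧ t 0 ∈ A ∧ ∀ i < k, IsVStructure G k t i ↔ t i ∈ M

theorem IsOpenTrail.isVStructure_iff_mem (h : IsOpenTrail G A M k t) (hk : t k ∉ M)
    (hi : i ≤ k) : IsVStructure G k t i ↔ t i ∈ M := by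
  rcases hi.lt_or_eq with hi | rfl
  · exact h.2.2 i hi
  · exact iff_of_false (fun hvs => lt_irrefl _ hvs.2.1) hk

theorem IsOpenTrail.isActive (h : IsOpenTrail G A M k t) (hk : t k ∉ M) : IsActive G k t M := by
  intro i hi
  rw [h.isVStructure_iff_mem hk hi]
  exact ⟨id, fun hiM => ⟨t i, hiM, .refl⟩⟩

theorem IsOpenTrail.extend (h : IsOpenTrail G A M k t) {w : V}
    (hw : G.Adj (t k) w ∨ G.Adj w (t k))
    (hk : heading G t k = .down ∧ G.Adj w (t k) ↔ t k ∈ M) :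
    ∃ t', IsOpenTrail G A M (k + 1) t' ∧ t' k = t k ∧ t' (k + 1) = w := by
  let t' := Function.update t (k + 1) w
  have t'_eq {i} (hi : i ≤ k) : t' i = t i := Function.update_of_ne (by omega) _ _
  have t'_succ : t' (k + 1) = w := Function.update_self _ _ _
  have heading_eq {i} (hi : i ≤ k) : heading G t' i = heading G t i := by
    rw [heading, heading, t'_eq hi, t'_eq ((i.sub_le 1).trans hi)]
  obtain ⟨htrail, h0, hM⟩ := h
  refine ⟨t', ⟨fun i hi => ?_, t'_eq k.zero_le ▸ h0, fun i hi => ?_⟩, t'_eq le_rfl, t'_succ⟩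
  · rcases (Nat.lt_succ_iff.1 hi).lt_or_eq with hik | rfl
    · rw [t'_eq hik.le, t'_eq hik]
      exact htrail i hik
    · rwa [t'_eq le_rfl, t'_succ]
  · rcases (Nat.lt_succ_iff.1 hi).lt_or_eq with hik | rfl
    · simp only [← hM i hik, isVStructure_iff, heading_eq hik.le, t'_eq hik.le, t'_eq hik, hi, hik]
    · simp only [isVStructure_iff, heading_eq le_rfl, t'_eq le_rfl, t'_succ, hi, hk, true_and]

theorem BayesBall.exists_isOpenTrail (hG : Acyclic G) {s : Heading} {v : V}
    (h : BayesBall G A M s v) :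
    ∃ k t, IsOpenTrail G A M k t ∧ t k = v ∧ heading G t k = s := by
  induction h with
  | @start a ha => exact ⟨0, fun _ => a, ⟨nofun, ha, nofun⟩, rfl, heading_zero⟩
  | down _ hvM hvw ih =>
    obtain ⟨k, t, ht, rfl, -⟩ := ih
    obtain ⟨t', ht', hk, rfl⟩ :=
      ht.extend (Or.inl hvw) (iff_of_false (fun hvs => hG.asymm hvw hvs.2) hvM)
    exact ⟨k + 1, t', ht', rfl, heading_succ_of_adj (hk ▸ hvw)⟩
  | up _ hvM huv ih =>
    obtain ⟨k, t, ht, rfl, rfl⟩ := ih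
    obtain ⟨t', ht', hk, rfl⟩ := ht.extend (Or.inr huv) ((and_iff_left huv).trans hvM)
    exact ⟨k + 1, t', ht', rfl, heading_succ_of_adj_symm hG (hk ▸ huv)⟩

theorem IsActive.bayesBall (hG : Acyclic G) (ht : IsTrail G k t) (h0 : t 0 ∈ A)
    (hact : IsActive G k t M) (hi : i ≤ k) : BayesBall G A M (heading G t i) (t i) := by
  induction i with
  | zero => exact heading_zero (G := G) (t := t) ▸ .start h0
  | succ i ih =>
    have h := ih (Nat.le_of_lt hi)
    obtain ⟨hnot, hdesc⟩ := hact i (Nat.le_of_lt hi)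
    rcases ht i hi with hadj | hadj
    · rw [heading_succ_of_adj hadj]
      exact h.down (hnot (not_isVStructure_of_adj hG (Or.inl rfl) hadj)) hadj
    rw [heading_succ_of_adj_symm hG hadj]
    have hvs : IsVStructure G k t i ↔ heading G t i = .down := by
      rw [isVStructure_iff, and_iff_right (Nat.lt_of_succ_le hi), and_iff_left hadj]
    by_cases hiM : t i ∈ M
    · exact h.up (iff_of_true (hvs.1 (by_contra fun hi => hnot hi hiM)) hiM) hadj
    · cases hs : heading G t i with
      | up => exact (hs ▸ h).up (iff_of_false nofun hiM) hadj
      | down =>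
        obtain ⟨m, hm, him⟩ := hdesc (hvs.2 hs)
        have hup := (hs ▸ h).up_of_reflTransGen him (fun hmM => (hmM hm).elim) hiM
        exact hup.up (iff_of_false nofun hiM) hadj

theorem DConnected.exists_isOpenTrail (hG : Acyclic G) {d : V} (h : DConnected G A M d) :
    ∃ k t, IsOpenTrail G A M k t ∧ t k = d := by
  obtain ⟨-, s, hs⟩ := h
  obtain ⟨k, t, ht, hk, -⟩ := hs.exists_isOpenTrail hG
  exact ⟨k, t, ht, hk⟩

theorem dSeparated_iff (hG : Acyclic G) :
    DSeparated G A D M ↔ ∀ d ∈ D, ¬ DConnected G A M d := by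
  constructor
  · intro h d hd hconn
    obtain ⟨k, t, ht, rfl⟩ := hconn.exists_isOpenTrail hG
    exact h k t ht.1 ht.2.1 hd (ht.isActive hconn.1)
  · intro h k t ht h0 hk hact
    have hkM : t k ∉ M := (hact k le_rfl).1 fun hvs => lt_irrefl k hvs.2.1
    exact h _ hk ⟨hkM, _, hact.bayesBall hG ht h0 le_rfl⟩

theorem isCompositionalGraphoid_dSeparated (hG : Acyclic G) (A : Set V) :
    IsCompositionalGraphoid (DSeparated G A) := by
  convert isCompositionalGraphoid_dconnected G A
  exact dSeparated_iff hG

end Trail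

section Ancestral

variable {V : Type*} {G : Digraph V} {A D M W : Set V}

/-- `W` contains the parents, hence the ancestors, of its elements. -/
def IsAncestral (G : Digraph V) (W : Set V) : Prop :=
  ∀ ⦃u v⦄, G.Adj u v → v ∈ W → u ∈ W

/-- The ancestors of the elements of `S`, including these elements. -/
def ancestors (G : Digraph V) (S : Set V) : Set V :=
  {v | ∃ z ∈ S, Relation.ReflTransGen G.Adj v z}

theorem isAncestral_ancestors (G : Digraph V) (S : Set V) : IsAncestral G (ancestors G S) :=
  fun _ _ huv ⟨z, hz, hvz⟩ => ⟨z, hz, .head huv hvz⟩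

theorem subset_ancestors (G : Digraph V) (S : Set V) : S ⊆ ancestors G S :=
  fun v hv => ⟨v, hv, .refl⟩

theorem Acyclic.exists_notMem_forall_adj_mem [Finite V] (hG : Acyclic G) (hW : W ≠ Set.univ) :
    ∃ v ∉ W, ∀ u, G.Adj u v → u ∈ W := by
  have : Std.Irrefl (Relation.TransGen G.Adj) := ⟨hG⟩
  obtain ⟨v, hv, hmin⟩ := (Finite.wellFounded_of_trans_of_irrefl
    (Relation.TransGen G.Adj)).has_min Wᶜ (Set.nonempty_compl.2 hW)
  exact ⟨v, hv, fun u huv => by_contra fun hu => hmin u hu (.single huv)⟩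

/-- The vertices outside `M` reached upwards from `A` by a Bayes ball. -/
def upReached (G : Digraph V) (A M : Set V) : Set V :=
  {v | v ∉ M ∧ BayesBall G A M .up v}

/-- The soundness of d-separation in graph terms: the set on either side is the scope of the
conditional distribution of `v` given its parents. -/
theorem family_subset_or_disjoint_upReached (h : ∀ d ∈ D, ¬ DConnected G A M d) {v : V}
    (hv : v ∈ ancestors G (A ∪ D ∪ M)) :
    {u | u = v ∨ G.Adj u v} ⊆ upReached G A M ∪ M ∨
      Disjoint {u | u = v ∨ G.Adj u v} (upReached G A M) := by
  have of_bayesBall {s} (hv : BayesBall G A M s v) (hs : s = .down ↔ v ∈ M)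
      (hvU : v ∈ upReached G A M ∪ M) : {u | u = v ∨ G.Adj u v} ⊆ upReached G A M ∪ M := by
    rintro u (rfl | huv)
    · exact hvU
    · exact (em (u ∈ M)).elim Or.inr fun huM => Or.inl ⟨huM, hv.up hs huv⟩
  have of_mem_upReached (hv : v ∈ upReached G A M) :
      {u | u = v ∨ G.Adj u v} ⊆ upReached G A M ∪ M :=
    of_bayesBall hv.2 (iff_of_false nofun hv.1) (Or.inl hv)
  refine or_iff_not_imp_right.2 fun hmeet => ?_
  obtain ⟨u, rfl | huv, huU⟩ := Set.not_disjoint_iff.1 hmeet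
  · exact of_mem_upReached huU
  have hdown : BayesBall G A M .down v := huU.2.down huU.1 huv
  by_cases hvM : v ∈ M
  · exact of_bayesBall hdown (iff_of_true rfl hvM) (Or.inr hvM)
  obtain ⟨z, hz, hvz⟩ := hv
  refine of_mem_upReached ⟨hvM, hdown.up_of_reflTransGen hvz (fun hzM hzdown => ?_) hvM⟩
  rcases hz with (hzA | hzD) | hzM'
  exacts [.start hzA, (h z hzD ⟨hzM, _, hzdown⟩).elim, (hzM hzM').elim]

end Ancestral

section Kernel

variable {V : Type*} {G : Digraph V} {𝒳 : V → Type} [∀ v, Fintype (𝒳 v)] {W : Set V}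
  {q : ∀ v, 𝒳 v → (∀ u : {u // G.Adj u v}, 𝒳 u) → ℝ}

/-- The factors of a directed model in which the variables outside `W` are made uniform and
independent of their parents. -/
noncomputable def ancestralFactor (q : ∀ v, 𝒳 v → (∀ u : {u // G.Adj u v}, 𝒳 u) → ℝ) (W : Set V)
    (v : V) (x : ∀ v, 𝒳 v) : ℝ :=
  open scoped Classical in if v ∈ W then q v (x v) fun u => x u else (Fintype.card (𝒳 v) : ℝ)⁻¹

theorem ancestralFactor_of_mem {v : V} (hv : v ∈ W) (x : ∀ v, 𝒳 v) :
    ancestralFactor q W v x = q v (x v) fun u => x u :=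
  if_pos hv

theorem ancestralFactor_of_notMem {v : V} (hv : v ∉ W) (x : ∀ v, 𝒳 v) :
    ancestralFactor q W v x = (Fintype.card (𝒳 v) : ℝ)⁻¹ :=
  if_neg hv

theorem dependsOn_ancestralFactor (v : V) :
    DependsOn (ancestralFactor q W v) {u | v ∈ W ∧ (u = v ∨ G.Adj u v)} := by
  intro x y hxy
  by_cases hv : v ∈ W
  · rw [ancestralFactor_of_mem hv, ancestralFactor_of_mem hv, hxy v ⟨hv, Or.inl rfl⟩]
    exact congrArg _ (funext fun u => hxy u ⟨hv, Or.inr u.2⟩)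
  · rw [ancestralFactor_of_notMem hv, ancestralFactor_of_notMem hv]

variable [Fintype V] [DecidableEq V] [∀ v, Nonempty (𝒳 v)]

theorem marginalEq_prod_ancestralFactor_insert (hq : ∀ v y, ∑ a, q v a y = 1)
    (hW : IsAncestral G W) {v : V} (hv : v ∉ W) (hparents : ∀ u, G.Adj u v → u ∈ W) :
    MarginalEq W (fun x => ∏ u, ancestralFactor q (insert v W) u x)
      (fun x => ∏ u, ancestralFactor q W u x) := by
  intro S hS
  have ne_of_mem {u} (hu : u ∈ W) : u ≠ v := fun huv => hv (huv ▸ hu)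
  let P : (∀ v, 𝒳 v) → ℝ := fun x => ∏ u ∈ Finset.univ.erase v, ancestralFactor q W u x
  have hP : DependsOn P {v}ᶜ := dependsOn_finset_prod fun u _ =>
    (dependsOn_ancestralFactor u).mono fun w hw => ne_of_mem <|
      hw.2.elim (fun hwu => hwu ▸ hw.1) fun hwu => hW hwu hw.1
  have hprod_insert (x : ∀ v, 𝒳 v) :
      ∏ u, ancestralFactor q (insert v W) u x = P x * q v (x v) fun u => x u := by
    rw [← Finset.prod_erase_mul _ _ (Finset.mem_univ v)]
    congr 1
    · refine Finset.prod_congr rfl fun u hu => ?_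
      by_cases huW : u ∈ W
      · rw [ancestralFactor_of_mem huW, ancestralFactor_of_mem (Set.mem_insert_of_mem v huW)]
      · rw [ancestralFactor_of_notMem huW, ancestralFactor_of_notMem]
        exact not_or.2 ⟨Finset.ne_of_mem_erase hu, huW⟩
    · exact ancestralFactor_of_mem (Set.mem_insert v W) x
  have hprod (x : ∀ v, 𝒳 v) :
      ∏ u, ancestralFactor q W u x = P x * (Fintype.card (𝒳 v) : ℝ)⁻¹ := by
    rw [← Finset.prod_erase_mul _ _ (Finset.mem_univ v), ancestralFactor_of_notMem hv]
  simp only [prob, hprod_insert, hprod, Set.indicator_mul_left]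
  refine sum_mul_eq_sum_mul_inv_card
    (dependsOn_indicator (hS.mono fun u hu => ne_of_mem hu) hP) fun x => ?_
  rw [← hq v fun u => x u]
  refine Finset.sum_congr rfl fun a _ => ?_
  rw [Function.update_self]
  exact congrArg _ (funext fun u => Function.update_of_ne (ne_of_mem (hparents u u.2)) _ _)

theorem marginalEq_prod_ancestralFactor (hG : Acyclic G) (hq : ∀ v y, ∑ a, q v a y = 1)
    (hW : IsAncestral G W) :
    MarginalEq W (fun x => ∏ v, q v (x v) fun u => x u)
      (fun x => ∏ v, ancestralFactor q W v x) := by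
  induction W using WellFoundedGT.induction with
  | _ W ih =>
  by_cases huniv : W = Set.univ
  · intro S _
    simp only [huniv, ancestralFactor_of_mem (Set.mem_univ _)]
  · obtain ⟨v, hv, hparents⟩ := hG.exists_notMem_forall_adj_mem huniv
    have hinsert : IsAncestral G (insert v W) := by
      rintro u w huw (rfl | hw)
      exacts [Or.inr (hparents u huw), Or.inr (hW huw hw)]
    intro S hS
    rw [ih _ (Set.ssubset_insert hv) hinsert S (hS.mono (Set.subset_insert v W)),
      marginalEq_prod_ancestralFactor_insert hq hW hv hparents S hS]

theorem directedFactorizes_prod (hG : Acyclic G)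
    (hq : ∀ v y, (fun a => q v a y) ∈ stdSimplex ℝ (𝒳 v)) :
    DirectedFactorizes G 𝒳 fun x => ∏ v, q v (x v) fun u => x u := by
  refine ⟨⟨fun x => Finset.prod_nonneg fun v _ => (hq v _).1 _, ?_⟩, q, hq, fun _ => rfl⟩
  have h := marginalEq_prod_ancestralFactor hG (fun v y => (hq v y).2) (W := ∅) nofun Set.univ
    fun _ _ _ => rfl
  simp only [prob, Set.indicator_univ, ancestralFactor_of_notMem (Set.notMem_empty _)] at h
  have hcard : (∏ v, (Fintype.card (𝒳 v) : ℝ)) ≠ 0 :=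
    Finset.prod_ne_zero_iff.2 fun v _ => Nat.cast_ne_zero.2 Fintype.card_ne_zero
  simp [h, Fintype.card_pi, hcard]

theorem exists_directedFactorizes_support (hG : Acyclic G)
    (R : ∀ v, 𝒳 v → (∀ u : {u // G.Adj u v}, 𝒳 u) → Prop) (hR : ∀ v y, ∃ a, R v a y) :
    ∃ p, DirectedFactorizes G 𝒳 p ∧ ∀ x, p x ≠ 0 ↔ ∀ v, R v (x v) fun u => x u := by
  classical
  let s v (y : ∀ u : {u // G.Adj u v}, 𝒳 u) : Finset (𝒳 v) := {a | R v a y}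
  have hcard v y : ((s v y).card : ℝ) ≠ 0 :=
    Nat.cast_ne_zero.2 (Finset.card_ne_zero.2 ((hR v y).imp fun a ha => by simp [s, ha]))
  let q v (a : 𝒳 v) (y : ∀ u : {u // G.Adj u v}, 𝒳 u) : ℝ :=
    if a ∈ s v y then ((s v y).card : ℝ)⁻¹ else 0
  refine ⟨_, directedFactorizes_prod (q := q) hG fun v y => ⟨fun a => by positivity, ?_⟩,
    fun x => ?_⟩
  · simp [q, hcard]
  · simp only [q, s, Finset.prod_ne_zero_iff, Finset.mem_univ, true_implies, ite_ne_right_iff,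
      Finset.mem_filter_univ]
    exact forall_congr' fun v => and_iff_left (inv_ne_zero (hcard v _))

end Kernel

theorem DirectedFactorizes.condIndep {V : Type*} [Fintype V] [DecidableEq V] {G : Digraph V}
    {𝒳 : V → Type} [∀ v, Fintype (𝒳 v)] {p : (∀ v, 𝒳 v) → ℝ} {A D M : Set V}
    (hp : DirectedFactorizes G 𝒳 p) (hG : Acyclic G) (hsep : DSeparated G A D M) :
    CondIndep p A D M := by
  obtain ⟨hsimplex, q, hq, hpq⟩ := hp
  have : Nonempty (∀ v, 𝒳 v) := by
    by_contra hempty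
    rw [not_nonempty_iff] at hempty
    simpa using hsimplex.2
  have hnonempty (v) : Nonempty (𝒳 v) := this.map fun x => x v
  have hconn := (dSeparated_iff hG).1 hsep
  have hsub : A ∪ D ∪ M ⊆ ancestors G (A ∪ D ∪ M) := subset_ancestors G _
  rw [Set.union_subset_iff, Set.union_subset_iff] at hsub
  rw [funext hpq]
  refine CondIndep.of_marginalEq ?_ (marginalEq_prod_ancestralFactor hG
    (fun v y => (hq v y).2) (isAncestral_ancestors G (A ∪ D ∪ M))) hsub.1.1 hsub.1.2 hsub.2
  refine condIndep_of_eq_prod (U := upReached G A M) 1 (fun x => (one_mul _).symm)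
    (fun v _ => dependsOn_ancestralFactor v) (fun v _ => ?_) (fun a ha => ?_) ?_ ?_
  · by_cases hv : v ∈ ancestors G (A ∪ D ∪ M)
    · simpa only [hv, true_and] using family_subset_or_disjoint_upReached hconn hv
    · simp [hv]
  · exact (em (a ∈ M)).elim Or.inr fun haM => Or.inl ⟨haM, .start ha⟩
  · exact Set.disjoint_left.2 fun d hd hdU => hconn d hd ⟨hdU.1, _, hdU.2⟩
  · exact Set.disjoint_left.2 fun v hvM hvU => hvU.1 hvM

section Completeness

variable {V : Type*} {G : Digraph V} {A D M : Set V} {t : ℕ → V} {i j k l : ℕ}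

/-- Whether the `i`-th bit at the vertex `v` may be `b`, given the values `y` at the parents of `v`,
in a model of bits that travel along the trail `t 0, …, t k`. The `i`-th bit lives at the vertex
`t i`. It is copied from the neighbours of `t i` on the trail that are parents of `t i`, except that
at a v-structure it may be `false` only if the bits of these two parents agree. The `i`-th bit is
free at the other vertices. -/
def TrailConstraint (G : Digraph V) (k : ℕ) (t : ℕ → V) (v : V)
    (y : {u // G.Adj u v} → Fin (k + 1) → Bool) (i : Fin (k + 1)) (b : Bool) : Prop :=
  t i = v →
    (¬ IsVStructure G k t i → ∀ (j : Fin (k + 1)) (hj : G.Adj (t j) v),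
      (j + 1 = (i : ℕ) ∨ i + 1 = (j : ℕ)) → b = y ⟨t j, hj⟩ j) ∧
    (IsVStructure G k t i → b = false → ∀ (j l : Fin (k + 1)) (hj : G.Adj (t j) v)
      (hl : G.Adj (t l) v), j + 1 = (i : ℕ) → i + 1 = (l : ℕ) → y ⟨t j, hj⟩ j = y ⟨t l, hl⟩ l)

theorem eq_of_not_isVStructure (hi : ¬ IsVStructure G k t i) (hj : j + 1 = i ∨ i + 1 = j)
    (hl : l + 1 = i ∨ i + 1 = l) (hjk : j ≤ k) (hlk : l ≤ k) (hjadj : G.Adj (t j) (t i))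
    (hladj : G.Adj (t l) (t i)) : j = l := by
  rcases hj with rfl | rfl <;> rcases hl with hl | rfl
  · omega
  · exact (hi ⟨j.succ_pos, hlk, hjadj, hladj⟩).elim
  · subst hl
    exact (hi ⟨l.succ_pos, hjk, hladj, hjadj⟩).elim
  · rfl

theorem exists_trailConstraint (G : Digraph V) (k : ℕ) (t : ℕ → V) (v : V)
    (y : {u // G.Adj u v} → Fin (k + 1) → Bool) (i : Fin (k + 1)) :
    ∃ b, TrailConstraint G k t v y i b := by
  by_cases hi : IsVStructure G k t i
  · exact ⟨true, fun _ => ⟨fun hi' => (hi' hi).elim, nofun⟩⟩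
  by_cases hparent : ∃ (j : Fin (k + 1)) (_ : G.Adj (t j) v), j + 1 = (i : ℕ) ∨ i + 1 = (j : ℕ)
  · obtain ⟨j, hj, hij⟩ := hparent
    refine ⟨y ⟨t j, hj⟩ j, fun hv => ⟨fun _ l hl hil => ?_, fun hi' => (hi hi').elim⟩⟩
    subst hv
    obtain rfl : j = l := Fin.ext
      (eq_of_not_isVStructure hi hij hil (Fin.is_le j) (Fin.is_le l) hj hl)
    rfl
  · exact ⟨true, fun _ => ⟨fun _ l hl hil => (hparent ⟨l, hl, hil⟩).elim,
      fun hi' => (hi hi').elim⟩⟩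

theorem trailConstraint_bit_eq (hG : Acyclic G) (ht : IsTrail G k t) {z : V → Fin (k + 1) → Bool}
    (hz : ∀ v i, TrailConstraint G k t v (fun u => z u) i (z v i))
    (hfalse : ∀ i : Fin (k + 1), IsVStructure G k t i → z (t i) i = false) (i : Fin (k + 1))
    (hi : ¬ IsVStructure G k t i) : z (t i) i = z (t 0) 0 := by
  obtain ⟨n, hn⟩ := i
  induction n using Nat.strong_induction_on with
  | _ n ih =>
  have copy (i j : Fin (k + 1)) (hi : ¬ IsVStructure G k t i)
      (hij : j + 1 = (i : ℕ) ∨ i + 1 = (j : ℕ)) (hadj : G.Adj (t j) (t i)) :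
      z (t i) i = z (t j) j := (hz (t i) i rfl).1 hi j hadj hij
  match n with
  | 0 => rfl
  | m + 1 =>
    by_cases hm : IsVStructure G k t m
    · obtain ⟨l, rfl⟩ := Nat.exists_eq_succ_of_ne_zero hm.1.ne'
      have hl : ¬ IsVStructure G k t l := not_isVStructure_of_adj hG (Or.inl rfl) hm.2.2.1
      rw [← ih l (by omega) (by omega) hl]
      exact ((hz (t (l + 1)) ⟨l + 1, by omega⟩ rfl).2 hm (hfalse ⟨l + 1, by omega⟩ hm) ⟨l, by omega⟩
        ⟨l + 2, hn⟩ hm.2.2.1 hm.2.2.2 rfl rfl).symm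
    · rw [← ih m (by omega) (by omega) hm]
      rcases ht m (by omega) with hadj | hadj
      · exact copy ⟨m + 1, hn⟩ ⟨m, by omega⟩ hi (Or.inl rfl) hadj
      · exact (copy ⟨m, by omega⟩ ⟨m + 1, hn⟩ hm (Or.inr rfl) hadj).symm

variable [Fintype V] [DecidableEq V]

theorem dSeparated_of_indep (hG : Acyclic G) (h : Indep (DirectedFactorizes G) A D M) :
    DSeparated G A D M := by
  classical
  refine (dSeparated_iff hG).2 fun d hd hconn => ?_
  obtain ⟨k, t, ht, rfl⟩ := hconn.exists_isOpenTrail hG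
  have mem_iff (i : Fin (k + 1)) : IsVStructure G k t i ↔ t i ∈ M :=
    ht.isVStructure_iff_mem hconn.1 (Fin.is_le i)
  obtain ⟨p, hp, hsupp⟩ := exists_directedFactorizes_support (𝒳 := fun _ => Fin (k + 1) → Bool)
    hG (fun v a y => ∀ i, TrailConstraint G k t v y i (a i))
    fun v y => Classical.skolem.1 (exists_trailConstraint G k t v y)
  have hy : p (fun _ _ => false) ≠ 0 :=
    (hsupp _).2 fun v i _ => ⟨fun _ _ _ _ => rfl, fun _ _ _ _ _ _ _ _ => rfl⟩
  let x : V → Fin (k + 1) → Bool := fun v i => decide (v = t i ∧ ¬ IsVStructure G k t i)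
  have hx : p x ≠ 0 := by
    refine (hsupp x).2 fun v i hv => ?_
    subst hv
    have parent_eq_true (j : Fin (k + 1)) (hj : G.Adj (t j) (t i))
        (hij : j + 1 = (i : ℕ) ∨ i + 1 = (j : ℕ)) : x (t j) j = true :=
      decide_eq_true ⟨rfl, not_isVStructure_of_adj hG hij hj⟩
    refine ⟨fun hi j hj hij => ?_, fun _ _ j l hj hl hij hil => ?_⟩
    · exact (decide_eq_true ⟨rfl, hi⟩).trans (parent_eq_true j hj hij).symm
    · exact (parent_eq_true j hj (Or.inl hij)).trans (parent_eq_true l hl (Or.inr hil)).symm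
  have hxM (v) (hv : v ∈ M) : x v = fun _ => false := funext fun i =>
    decide_eq_false fun hvi => hvi.2 ((mem_iff i).2 (hvi.1 ▸ hv))
  obtain ⟨z, hz, hzA, hzD, hzM⟩ := (h _ p hp).exists_ne_zero hp.1.1 hx hy hxM
  have hbit : z (t k) (Fin.last k) = z (t 0) 0 :=
    trailConstraint_bit_eq hG ht.1 ((hsupp z).1 hz)
      (fun i hi => congrFun (hzM _ ((mem_iff i).1 hi)) i) (Fin.last k)
      fun hi => hconn.1 ((mem_iff (Fin.last k)).1 hi)
  have hstart : z (t 0) 0 = true :=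
    (congrFun (hzA _ ht.2.1) 0).trans (decide_eq_true ⟨rfl, fun hi => hi.1.ne rfl⟩)
  exact Bool.false_ne_true ((congrFun (hzD _ hd) _).symm.trans (hbit.trans hstart))

theorem indep_directedFactorizes_iff (hG : Acyclic G) :
    Indep (DirectedFactorizes G) A D M ↔ DSeparated G A D M :=
  ⟨dSeparated_of_indep hG, fun hsep _ _ _ hp => hp.condIndep hG hsep⟩

theorem isCompositionalGraphoid_indep_directedFactorizes (hG : Acyclic G) (A : Set V) :
    IsCompositionalGraphoid (Indep (DirectedFactorizes G) A) := by
  have h : Indep (DirectedFactorizes G) A = DSeparated G A :=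
    funext₂ fun _ _ => propext (indep_directedFactorizes_iff hG)
  exact h ▸ isCompositionalGraphoid_dSeparated hG A

end Completeness

end GraphicalModel

theorem mainTheorem2 {V : Type*} [Fintype V] [DecidableEq V] (B C C' E : Set V)
    (hB : B ∩ (C ∪ C') ⊆ E) :
    (∀ G : SimpleGraph V,
      IsMarkovBlanket (UndirectedFactorizes G) B C E (mb (UndirectedFactorizes G) C B E) ∧
      IsMarkovBlanket (UndirectedFactorizes G) B (C ∪ C') E
        (mb (UndirectedFactorizes G) (C ∪ C') B E) ∧
      (mb (UndirectedFactorizes G) (C ∪ C') B E = mb (UndirectedFactorizes G) C B E ↔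
        Separated G C' B (C ∪ E))) ∧
    (∀ G : Digraph V, Acyclic G →
      IsMarkovBlanket (DirectedFactorizes G) B C E (mb (DirectedFactorizes G) C B E) ∧
      IsMarkovBlanket (DirectedFactorizes G) B (C ∪ C') E
        (mb (DirectedFactorizes G) (C ∪ C') B E) ∧
      (mb (DirectedFactorizes G) (C ∪ C') B E = mb (DirectedFactorizes G) C B E ↔
        DSeparated G C' B (C ∪ E))) := by
  have hBC : B ∩ C ⊆ E := fun v hv => hB ⟨hv.1, Or.inl hv.2⟩
  refine ⟨fun G => ?_, fun G hG => ?_⟩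
  · have h := isCompositionalGraphoid_indep_undirectedFactorizes G B
    refine ⟨h.isMarkovBlanket hBC, h.isMarkovBlanket hB, ?_⟩
    rw [h.mb_union_eq_iff hB, indep_comm, indep_undirectedFactorizes_iff]
  · have h := isCompositionalGraphoid_indep_directedFactorizes hG B
    refine ⟨h.isMarkovBlanket hBC, h.isMarkovBlanket hB, ?_⟩
    rw [h.mb_union_eq_iff hB, indep_comm, indep_directedFactorizes_iff hG]
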